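/- A network on a finite set $X$ is a function $\omega:X\times X\to[0,\infty]$, where $\omega(x,y)=\infty$ means that there is no edge from $x$ to $y$; let $P(G)=(X,d)$ be its path completion, where $d(x,y)$ is the infimum of the total weights $\sum_i\omega(x_i,x_{i+1})$ of finite sequences of vertices from $x$ to $y$ (the constant sequence has weight $0$). For $\delta\in[0,\infty]$ let $\mathfrak D_\delta(G)$ be the Dowker source complex of $P(G)$: a nonempty $\sigma\subseteq X$ is a simplex iff there is $x\in X$ with $d(x,y)\le\delta$ for all $y\in\sigma$. $H_1$ denotes simplicial homology with real coefficients. A source dominating set of $P(G)$ is a set $K\subseteq X$ such that every $x\in X$ satisfies $d(k,x)<\infty$ for some $k\in K$. Let $n\ge 3$ and let $G=(\mathbb Z/n\mathbb Z,\omega)$ be a weighted oriented cycle graph: two distinct vertices are joined by an edge (of finite weight) iff they are cyclically consecutive, and each such edge has exactly one orientation. Let $w_i$ be the weight of the edge between $i$ and $i+1$. Assume that $G$ is inconsistently oriented, i.e. the edges do not all point in the same direction around the cycle. Let $K$ be a minimal source dominating set of $P(G)$ and suppose $|K|=1$. Then $K=\{k\}$, where $k$ is the only source of $G$ (vertex without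 incoming edges from other vertices), and $G$ has exactly one sink $s$ (vertex without outgoing edges to other vertices). Let $A_+$ and $A_-$ be the sets of interior vertices of the two directed paths from $k$ to $s$ in the cycle (for $k=0$: $A_+=\{i:0<i<s\}$, $A_-=\{i:s<i<n\}$), and put $$B=\max_{A\in\{A_+,A_-\}}\ \min_{i\in A}\ \max\{d(k,s),d(k,i),d(i,s)\},$$ where the minimum over $A=\emptyset$ is read as $d(k,s)$. Then for every $\delta\in[0,\infty]$, $\dim H_1(\mathfrak D_\delta(G))=1$ if $\max_i w_i\le\delta<B$, and $H_1(\mathfrak D_\delta(G))=0$ otherwise. -/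

import Mathlib

open scoped ENNReal

namespace DowkerCycle

noncomputable section

/-! ### Simplicial homology with real coefficients -/

/-- The `k`-simplices of an abstract simplicial complex: the faces with `k + 1` vertices. -/
abbrev Simplices {V : Type*} (X : PreAbstractSimplicialComplex V) (k : ℕ) : Type _ :=
  {σ : Finset V // σ ∈ X ∧ σ.card = k + 1}

/-- The `i`-th face of a `(k + 1)`-simplex `[v₀ < v₁ < ⋯]`, obtained by omitting the vertex
`vᵢ`. -/
def face {V : Type*} [LinearOrder V] {X : PreAbstractSimplicialComplex V} {k : ℕ}
    (σ : Simplices X (k + 1)) (i : Fin (k + 2)) : Simplices X k :=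
  ⟨σ.1.erase (σ.1.orderEmbOfFin σ.2.2 i), by
    have hmem : σ.1.orderEmbOfFin σ.2.2 i ∈ σ.1 := Finset.orderEmbOfFin_mem _ _ _
    have hcard : (σ.1.erase (σ.1.orderEmbOfFin σ.2.2 i)).card = k + 1 := by
      rw [Finset.card_erase_of_mem hmem, σ.2.2]
      rfl
    refine ⟨(X.isRelLowerSet_faces σ.2.1).2 (Finset.erase_subset _ _) ?_, hcard⟩
    exact Finset.card_pos.mp (by omega)⟩

/-- The real vector space of `k`-chains. -/
abbrev Chains {V : Type*} (X : PreAbstractSimplicialComplex V) (k : ℕ) : Type _ :=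
  Simplices X k →₀ ℝ

/-- The boundary map `∂ₖ₊₁ : Cₖ₊₁ → Cₖ`, sending `[v₀, …, vₖ₊₁]` to
`∑ᵢ (-1)ⁱ [v₀, …, v̂ᵢ, …, vₖ₊₁]`. -/
def boundary {V : Type*} [LinearOrder V] (X : PreAbstractSimplicialComplex V) (k : ℕ) :
    Chains X (k + 1) →ₗ[ℝ] Chains X k :=
  Finsupp.linearCombination ℝ fun σ : Simplices X (k + 1) =>
    ∑ i : Fin (k + 2), Finsupp.single (face σ i) ((-1 : ℝ) ^ (i : ℕ))

/-- The `k`-cycles (every `0`-chain is a cycle). -/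
def cycles {V : Type*} [LinearOrder V] (X : PreAbstractSimplicialComplex V) :
    (k : ℕ) → Submodule ℝ (Chains X k)
  | 0 => ⊤
  | k + 1 => LinearMap.ker (boundary X k)

/-- The `k`-boundaries. -/
def boundaries {V : Type*} [LinearOrder V] (X : PreAbstractSimplicialComplex V) (k : ℕ) :
    Submodule ℝ (Chains X k) :=
  LinearMap.range (boundary X k)

/-- The quotient of a subspace `Z` by (the part in `Z` of) a subspace `B`. -/
abbrev SubQuotient {M : Type*} [AddCommGroup M] [Module ℝ M] (Z B : Submodule ℝ M) : Type _ :=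
  Z ⧸ B.submoduleOf Z

/-- The `k`-th simplicial homology `Hₖ(X)`: cycles modulo boundaries. -/
abbrev Homology {V : Type*} [LinearOrder V] (X : PreAbstractSimplicialComplex V) (k : ℕ) : Type _ :=
  SubQuotient (cycles X k) (boundaries X k)

/-! ### Networks, path completion, Dowker filtration -/

/-- A network (weighted digraph) on the vertex set `X`: a weight in `[0, ∞]` for every ordered pair
of vertices. The value `∞` means that there is no edge. -/
abbrev Network (X : Type*) : Type _ := X → X → ℝ≥0∞

/-- The path completion of a network: the weight of `(x, y)` is the infimum, over all finite
sequences `p 0 = x, p 1, …, p m = y` of vertices, of the total weight of the sequence. -/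
def pathCompletion {X : Type*} (ω : Network X) : Network X := fun x y =>
  ⨅ (m : ℕ) (p : Fin (m + 1) → X) (_ : p 0 = x) (_ : p (Fin.last m) = y),
    ∑ i : Fin m, ω (p i.castSucc) (p i.succ)

/-- The Dowker complex of a relation whose simplices are the nonempty finite sets of elements
having a common source. -/
def dowkerComplex {X Y : Type*} (R : X → Y → Prop) : PreAbstractSimplicialComplex Y where
  faces := {σ | σ.Nonempty ∧ ∃ x, ∀ y ∈ σ, R x y}
  isRelLowerSet_faces := by
    rintro σ ⟨hσ, x, hx⟩
    exact ⟨hσ, fun τ hτ hne => ⟨hne, x, fun y hy => hx y (hτ hy)⟩⟩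

/-- The Dowker source filtration of a network at scale `δ`: a nonempty set `σ` of vertices is a
simplex when some vertex `x` has shortest-path distance at most `δ` to every element of `σ`. -/
def dowkerFiltration {X : Type*} (ω : Network X) (δ : ℝ≥0∞) : PreAbstractSimplicialComplex X :=
  dowkerComplex fun x y => pathCompletion ω x y ≤ δ

/-- Every vertex is reached with finite weight from some element of `K`. -/
def IsSourceDominating {X : Type*} (ω : Network X) (K : Finset X) : Prop :=
  ∀ x, ∃ k ∈ K, ω k x < ∞

/-- A source: all finite-weight edges at `v` point outward. -/
def IsSource {X : Type*} (ω : Network X) (v : X) : Prop := ∀ u, u ≠ v → ω u v = ∞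

/-- A sink: all finite-weight edges at `v` point inward. -/
def IsSink {X : Type*} (ω : Network X) (v : X) : Prop := ∀ u, u ≠ v → ω v u = ∞

/-! ### Cycle networks on `Fin n = ℤ / nℤ` -/

/-- A weighted oriented cycle graph: distinct vertices are joined by an edge exactly when they are
cyclically consecutive, and each edge has exactly one orientation. -/
structure IsCycleNetwork {n : ℕ} [NeZero n] (ω : Network (Fin n)) : Prop where
  edge_iff : ∀ i j, i ≠ j → ((ω i j < ∞ ∨ ω j i < ∞) ↔ (j = i + 1 ∨ i = j + 1))
  oriented : ∀ i j, i ≠ j → ¬ (ω i j < ∞ ∧ ω j i < ∞)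

/-- All edges point in the same direction around the cycle. -/
def IsConsistentlyOriented {n : ℕ} [NeZero n] (ω : Network (Fin n)) : Prop :=
  (∀ i, ω i (i + 1) < ∞) ∨ (∀ i, ω (i + 1) i < ∞)

/-- The maximum edge weight of a cycle network. Exactly one of `ω i (i + 1)`, `ω (i + 1) i` is
finite, and the minimum picks the weight of the edge between `i` and `i + 1`. -/
def maxEdgeWeight {n : ℕ} [NeZero n] (ω : Network (Fin n)) : ℝ≥0∞ :=
  Finset.univ.sup' Finset.univ_nonempty fun i => min (ω i (i + 1)) (ω (i + 1) i)

/-- The vertices strictly between `k` and `s` going from `k` in the positive direction; for `k = 0`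
these are the `i` with `0 < i < s`. -/
def arcPos {n : ℕ} (k s : Fin n) : Finset (Fin n) :=
  Finset.univ.filter fun i => 0 < (i - k).val ∧ (i - k).val < (s - k).val

/-- The vertices strictly between `k` and `s` going from `k` in the negative direction; for `k = 0`
these are the `i` with `s < i < n`. -/
def arcNeg {n : ℕ} (k s : Fin n) : Finset (Fin n) :=
  Finset.univ.filter fun i => (s - k).val < (i - k).val

/-- `min_{i ∈ A} max {d(k,s), d(k,i), d(i,s)}`; when the path from `k` to `s` is a single edge
(`A = ∅`) the value is `d(k,s)`. -/
def arcValue {X : Type*} (d : Network X) (k s : X) (A : Finset X) : ℝ≥0∞ :=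
  open Classical in
  if h : A.Nonempty then A.inf' h fun i => max (d k s) (max (d k i) (d i s)) else d k s

/-- The value at which the first homology class dies. -/
def deathValue {n : ℕ} (ω : Network (Fin n)) (k s : Fin n) : ℝ≥0∞ :=
  max (arcValue (pathCompletion ω) k s (arcPos k s)) (arcValue (pathCompletion ω) k s (arcNeg k s))

end

end DowkerCycle

/-! Since `k` reaches every vertex and the orientation is not consistent, the cycle splits into two
directed paths from `k` to a sink `s` (`exists_isBipath`).

Upper bound, for finite `δ`. The vertices of a simplex lie in a `δ`-ball around some `x`. Coning
with `x` inside the ball makes every edge of the complex homologous to a sum of network edges of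
weight at most `δ` (`cycles_le_of_network_potential`). Hence `H_1` is spanned by the sum of the
edges around the cycle, the fundamental chain, and it vanishes if some edge is heavier than `δ`.

Filling. Let all weights be at most `δ`. If `i` on an arc satisfies `d(k,s), d(k,i), d(i,s) ≤ δ`,
then the arc is homologous to the single edge `[k,s]`: use the ball of `k` up to `i`, the ball of
`i` up to `s`, and the triangle `k, i, s`. For `δ ≥ B` this works on both arcs, and the fundamental
chain, being their difference, bounds.

Obstruction. If it fails on an arc `A`, the antisymmetrised indicator of the pairs `(s, v)` with `v
∈ A`, `d(v,s) ≤ δ` is a cocycle (`sinkIndicator_cocycle`). Exactly one neighbour of `s` lies in `A`,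
so its value on the fundamental chain is `±1`. -/

namespace DowkerCycle

noncomputable section

/-! ### Oriented edges, potentials and cocycles in degree one -/

section Chains

variable {V : Type*} [LinearOrder V] {X : PreAbstractSimplicialComplex V}

/-- The oriented edge from `u` to `v` as a chain; it is `0` when `{u, v}` is not a `1`-simplex. -/
def orientedEdge (X : PreAbstractSimplicialComplex V) (u v : V) : Chains X 1 :=
  open Classical in
  if h : ({u, v} : Finset V) ∈ X ∧ ({u, v} : Finset V).card = 1 + 1 then
    Finsupp.single ⟨{u, v}, h⟩ (if u < v then 1 else -1)
  else 0

theorem orientedEdge_self (u : V) : orientedEdge X u u = 0 := by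
  simp [orientedEdge]

theorem orientedEdge_swap (u v : V) : orientedEdge X v u = - orientedEdge X u v := by
  rcases eq_or_ne u v with rfl | hne
  · simp [orientedEdge_self]
  · unfold orientedEdge
    have hp : ({v, u} : Finset V) = {u, v} := Finset.pair_comm _ _
    by_cases h : ({u, v} : Finset V) ∈ X ∧ ({u, v} : Finset V).card = 1 + 1
    · have h' : ({v, u} : Finset V) ∈ X ∧ ({v, u} : Finset V).card = 1 + 1 := by rwa [hp]
      rw [dif_pos h, dif_pos h']
      have : (⟨{v, u}, h'⟩ : Simplices X 1) = ⟨{u, v}, h⟩ := Subtype.ext hp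
      rw [this, ← Finsupp.single_neg]
      rcases lt_or_gt_of_ne hne with h1 | h1
      · simp [h1, h1.not_gt]
      · simp [h1, h1.not_gt]
    · have h' : ¬ (({v, u} : Finset V) ∈ X ∧ ({v, u} : Finset V).card = 1 + 1) := by rwa [hp]
      rw [dif_neg h, dif_neg h', neg_zero]

theorem orientedEdge_of_lt {u v : V} (huv : u < v) (h : ({u, v} : Finset V) ∈ X) :
    orientedEdge X u v = Finsupp.single ⟨{u, v}, h, Finset.card_pair huv.ne⟩ 1 := by
  unfold orientedEdge
  rw [dif_pos ⟨h, Finset.card_pair huv.ne⟩, if_pos huv]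

theorem exists_eq_pair (σ : Simplices X 1) :
    ∃ (u v : V) (huv : u < v) (h : ({u, v} : Finset V) ∈ X),
      σ = ⟨{u, v}, h, Finset.card_pair huv.ne⟩ := by
  obtain ⟨σ, hσ, hc⟩ := σ
  obtain ⟨u, v, hne, rfl⟩ := Finset.card_eq_two.mp hc
  rcases lt_or_gt_of_ne hne with h | h
  · exact ⟨u, v, h, hσ, rfl⟩
  · exact ⟨v, u, h, by rwa [Finset.pair_comm], Subtype.ext (Finset.pair_comm _ _)⟩

theorem exists_eq_triple (σ : Simplices X 2) :
    ∃ (u v w : V) (_ : u < v) (_ : v < w), σ.1 = {u, v, w} := by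
  have hmono := (σ.1.orderEmbOfFin σ.2.2).strictMono
  refine ⟨σ.1.orderEmbOfFin σ.2.2 0, σ.1.orderEmbOfFin σ.2.2 1, σ.1.orderEmbOfFin σ.2.2 2,
    hmono (by decide), hmono (by decide), ?_⟩
  have h := Finset.image_orderEmbOfFin_univ σ.1 σ.2.2
  refine h.symm.trans ?_
  ext x
  simp only [Finset.mem_image, Finset.mem_univ, true_and, Finset.mem_insert,
    Finset.mem_singleton, eq_comm (a := x)]
  constructor
  · rintro ⟨i, rfl⟩
    fin_cases i <;> simp
  · rintro (h | h | h) <;> exact ⟨_, h⟩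

theorem orderEmbOfFin_pair {u v : V} (huv : u < v) {τ : Finset V} (hτ : τ = {u, v})
    (h : τ.card = 1 + 1) : τ.orderEmbOfFin h 0 = u ∧ τ.orderEmbOfFin h 1 = v := by
  subst hτ
  have := Finset.orderEmbOfFin_unique (s := {u, v}) h (f := ![u, v])
    (by intro i; fin_cases i <;> simp)
    (by intro i j hij; fin_cases i <;> fin_cases j <;> simp_all)
  rw [← this]
  simp

theorem orderEmbOfFin_triple {u v w : V} (huv : u < v) (hvw : v < w) {τ : Finset V}
    (hτ : τ = {u, v, w}) (h : τ.card = 2 + 1) :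
    τ.orderEmbOfFin h 0 = u ∧ τ.orderEmbOfFin h 1 = v ∧ τ.orderEmbOfFin h 2 = w := by
  subst hτ
  have := Finset.orderEmbOfFin_unique (s := {u, v, w}) h (f := ![u, v, w])
    (by intro i; fin_cases i <;> simp)
    (by
      have := huv.trans hvw
      intro i j hij; fin_cases i <;> fin_cases j <;> simp_all)
  rw [← this]
  simp

theorem boundary_single {k : ℕ} (σ : Simplices X (k + 1)) :
    boundary X k (Finsupp.single σ 1) =
      ∑ i : Fin (k + 2), Finsupp.single (face σ i) ((-1 : ℝ) ^ (i : ℕ)) := by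
  simp [boundary, Finsupp.linearCombination_single]

theorem boundary_single_pair {u v : V} (huv : u < v) (h : ({u, v} : Finset V) ∈ X)
    (hu : ({u} : Finset V) ∈ X) (hv : ({v} : Finset V) ∈ X) :
    boundary X 0 (Finsupp.single ⟨{u, v}, h, Finset.card_pair huv.ne⟩ 1) =
      Finsupp.single ⟨{v}, hv, rfl⟩ 1 - Finsupp.single ⟨{u}, hu, rfl⟩ 1 := by
  obtain ⟨e0, e1⟩ := orderEmbOfFin_pair huv rfl (Finset.card_pair huv.ne)
  rw [boundary_single, Fin.sum_univ_two]
  have f0 : face (⟨{u, v}, h, Finset.card_pair huv.ne⟩ : Simplices X 1) 0 = ⟨{v}, hv, rfl⟩ := by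
    apply Subtype.ext
    change ({u, v} : Finset V).erase _ = _
    erw [e0]
    ext x; simp; grind
  have f1 : face (⟨{u, v}, h, Finset.card_pair huv.ne⟩ : Simplices X 1) 1 = ⟨{u}, hu, rfl⟩ := by
    apply Subtype.ext
    change ({u, v} : Finset V).erase _ = _
    erw [e1]
    ext x; simp; grind
  rw [f0, f1]
  simp [sub_eq_add_neg]

theorem pair_mem_of_subset {σ : Finset V} (hσ : σ ∈ X) {u v : V} (hu : u ∈ σ) (hv : v ∈ σ) :
    ({u, v} : Finset V) ∈ X :=
  (X.isRelLowerSet_faces hσ).2 (by intro x; simp; rintro (rfl | rfl) <;> assumption) (by simp)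

theorem boundary_single_triple {u v w : V} (huv : u < v) (hvw : v < w) (σ : Simplices X 2)
    (hσ : σ.1 = {u, v, w}) :
    boundary X 1 (Finsupp.single σ 1) =
      orientedEdge X v w - orientedEdge X u w + orientedEdge X u v := by
  have huw := huv.trans hvw
  obtain ⟨e0, e1, e2⟩ := orderEmbOfFin_triple huv hvw hσ σ.2.2
  have mu : u ∈ σ.1 := by rw [hσ]; simp
  have mv : v ∈ σ.1 := by rw [hσ]; simp
  have mw : w ∈ σ.1 := by rw [hσ]; simp
  rw [boundary_single, Fin.sum_univ_three, orientedEdge_of_lt hvw (pair_mem_of_subset σ.2.1 mv mw),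
    orientedEdge_of_lt huw (pair_mem_of_subset σ.2.1 mu mw),
    orientedEdge_of_lt huv (pair_mem_of_subset σ.2.1 mu mv)]
  have f0 : face σ 0 = ⟨{v, w}, pair_mem_of_subset σ.2.1 mv mw, Finset.card_pair hvw.ne⟩ := by
    apply Subtype.ext
    change σ.1.erase _ = _
    erw [e0]
    refine (congrArg (Finset.erase · u) hσ).trans ?_
    ext x; simp; grind
  have f1 : face σ 1 = ⟨{u, w}, pair_mem_of_subset σ.2.1 mu mw, Finset.card_pair huw.ne⟩ := by
    apply Subtype.ext
    change σ.1.erase _ = _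
    erw [e1]
    refine (congrArg (Finset.erase · v) hσ).trans ?_
    ext x; simp; grind
  have f2 : face σ 2 = ⟨{u, v}, pair_mem_of_subset σ.2.1 mu mv, Finset.card_pair huv.ne⟩ := by
    apply Subtype.ext
    change σ.1.erase _ = _
    erw [e2]
    refine (congrArg (Finset.erase · w) hσ).trans ?_
    ext x; simp; grind
  rw [f0, f1, f2]
  simp [sub_eq_add_neg]

theorem boundary_orientedEdge {u v : V} (h : ({u, v} : Finset V) ∈ X)
    (hX : ∀ v : V, ({v} : Finset V) ∈ X) :
    boundary X 0 (orientedEdge X u v) =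
      Finsupp.single ⟨{v}, hX v, rfl⟩ 1 - Finsupp.single ⟨{u}, hX u, rfl⟩ 1 := by
  rcases lt_trichotomy u v with huv | rfl | huv
  · rw [orientedEdge_of_lt huv h, boundary_single_pair huv h (hX u) (hX v)]
  · simp [orientedEdge_self]
  · rw [Finset.pair_comm] at h
    rw [orientedEdge_swap, orientedEdge_of_lt huv h, map_neg,
      boundary_single_pair huv h (hX v) (hX u), neg_sub]

theorem orientedEdge_triangle_of_lt {u v w : V} (huv : u < v) (hvw : v < w)
    (h : ({u, v, w} : Finset V) ∈ X) :
    orientedEdge X u v + orientedEdge X v w - orientedEdge X u w ∈ boundaries X 1 := by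
  have hc : ({u, v, w} : Finset V).card = 2 + 1 :=
    Finset.card_eq_three.mpr ⟨u, v, w, huv.ne, (huv.trans hvw).ne, hvw.ne, rfl⟩
  refine ⟨Finsupp.single ⟨{u, v, w}, h, hc⟩ 1, ?_⟩
  rw [boundary_single_triple huv hvw _ rfl]
  abel

/-- The boundary of a possibly degenerate triangle is a boundary. -/
theorem orientedEdge_triangle {u v w : V} (h : ({u, v, w} : Finset V) ∈ X) :
    orientedEdge X u v + orientedEdge X v w - orientedEdge X u w ∈ boundaries X 1 := by
  -- Up to sign, every ordering of the three vertices reduces to the increasing one.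
  have key : ∀ {a b c : V}, a < b → b < c → ({a, b, c} : Finset V) = {u, v, w} →
      orientedEdge X a b + orientedEdge X b c - orientedEdge X a c ∈ boundaries X 1 :=
    fun hab hbc he => orientedEdge_triangle_of_lt hab hbc (he ▸ h)
  rcases lt_trichotomy u v with h1 | rfl | h1
  · rcases lt_trichotomy v w with h2 | rfl | h2
    · exact key h1 h2 rfl
    · simp [orientedEdge_self]
    · rcases lt_trichotomy u w with h3 | rfl | h3
      · have := neg_mem (key h3 h2 (by ext; simp; grind))
        rw [orientedEdge_swap w v]
        convert this using 1; abel
      · simp [orientedEdge_self, orientedEdge_swap u v]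
      · have := key h3 h1 (by ext; simp; grind)
        rw [orientedEdge_swap w v, orientedEdge_swap w u]
        convert this using 1; abel
  · simp [orientedEdge_self]
  · rcases lt_trichotomy v w with h2 | rfl | h2
    · rcases lt_trichotomy u w with h3 | rfl | h3
      · have := neg_mem (key h1 h3 (by ext; simp; grind))
        rw [orientedEdge_swap v u]
        convert this using 1; abel
      · simp [orientedEdge_self, orientedEdge_swap u v]
      · have := key h2 h3 (by ext; simp; grind)
        rw [orientedEdge_swap v u, orientedEdge_swap w u]
        convert this using 1; abel
    · simp [orientedEdge_self]
    · have := neg_mem (key h2 h1 (by ext; simp; grind))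
      rw [orientedEdge_swap v u, orientedEdge_swap w u, orientedEdge_swap w v]
      convert this using 1; abel

/-- If, modulo a subspace `M`, all edges are differences of values of a function on the vertices,
then all `1`-cycles lie in `M`. -/
theorem cycles_one_le_of_potential (M : Submodule ℝ (Chains X 1)) (S : V → Chains X 1)
    (hS : ∀ u v, ({u, v} : Finset V) ∈ X → orientedEdge X u v - (S v - S u) ∈ M) :
    cycles X 1 ≤ M := by
  have hne : ∀ τ : Simplices X 0, τ.1.Nonempty := fun τ => Finset.card_pos.mp (by rw [τ.2.2]; simp)
  -- `Φ` extends `S` linearly to `0`-chains; `min'` only extracts the vertex of a singleton. The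
  -- potential says that `Φ ∘ ∂` is the identity modulo `M`, so `∂z = 0` gives `z ∈ M`.
  let Φ : Chains X 0 →ₗ[ℝ] Chains X 1 :=
    Finsupp.linearCombination ℝ fun τ : Simplices X 0 => S (τ.1.min' (hne τ))
  have key : ∀ z : Chains X 1, z - Φ (boundary X 0 z) ∈ M := by
    intro z
    induction z using Finsupp.induction_linear with
    | zero => simp
    | add f g hf hg =>
      have := add_mem hf hg
      rw [map_add, map_add]
      convert this using 1; abel
    | single σ a =>
      obtain ⟨u, v, huv, h, rfl⟩ := exists_eq_pair σ
      have hu : ({u} : Finset V) ∈ X := by simpa using pair_mem_of_subset h (u := u) (v := u)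
      have hv : ({v} : Finset V) ∈ X := by simpa using pair_mem_of_subset h (u := v) (v := v)
      have h1 := hS u v h
      have h2 : Finsupp.single (⟨{u, v}, h, Finset.card_pair huv.ne⟩ : Simplices X 1) a =
          a • Finsupp.single (⟨{u, v}, h, Finset.card_pair huv.ne⟩ : Simplices X 1) (1 : ℝ) := by
        simp
      rw [h2, map_smul, map_smul, ← smul_sub, boundary_single_pair huv h hu hv]
      apply M.smul_mem
      rw [orientedEdge_of_lt huv h] at h1
      simpa [Φ, Finsupp.linearCombination_single] using h1
  intro z hz
  have hz' : boundary X 0 z = 0 := hz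
  simpa [hz'] using key z

theorem homology_one_subsingleton (h : cycles X 1 ≤ boundaries X 1) :
    Subsingleton (Homology X 1) := by
  refine Submodule.Quotient.subsingleton_iff.mpr ?_
  rw [Submodule.submoduleOf, Submodule.comap_subtype_eq_top]
  exact h

theorem finrank_homology_one_eq_one {z : Chains X 1} (hz : z ∈ cycles X 1)
    (hle : cycles X 1 ≤ boundaries X 1 ⊔ Submodule.span ℝ {z}) (φ : Chains X 1 →ₗ[ℝ] ℝ)
    (hφ : ∀ b, φ (boundary X 1 b) = 0) (hφz : φ z ≠ 0) :
    Module.finrank ℝ (Homology X 1) = 1 := by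
  refine finrank_eq_one (Submodule.Quotient.mk ⟨z, hz⟩) ?_ ?_
  · intro h0
    rw [Submodule.Quotient.mk_eq_zero] at h0
    obtain ⟨b, hb⟩ : z ∈ boundaries X 1 := h0
    exact hφz (by rw [← hb, hφ])
  · intro w
    obtain ⟨⟨w, hw⟩, rfl⟩ := Submodule.Quotient.mk_surjective _ w
    obtain ⟨b, hb, y, hy, hbw⟩ := Submodule.mem_sup.mp (hle hw)
    obtain ⟨c, rfl⟩ := Submodule.mem_span_singleton.mp hy
    refine ⟨c, ?_⟩
    rw [← Submodule.Quotient.mk_smul, Submodule.Quotient.eq]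
    change c • z - w ∈ boundaries X 1
    rw [← hbw]
    simpa using neg_mem hb

/-- The functional on `1`-chains defined by a function of pairs of vertices. -/
def edgeFunctional (X : PreAbstractSimplicialComplex V) (f : V → V → ℝ) : Chains X 1 →ₗ[ℝ] ℝ :=
  Finsupp.linearCombination ℝ fun σ : Simplices X 1 =>
    f (σ.1.orderEmbOfFin σ.2.2 0) (σ.1.orderEmbOfFin σ.2.2 1)

theorem edgeFunctional_orientedEdge {f : V → V → ℝ} (hf : ∀ u v, f v u = - f u v) {u v : V}
    (h : ({u, v} : Finset V) ∈ X) : edgeFunctional X f (orientedEdge X u v) = f u v := by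
  have key : ∀ {u v : V}, u < v → ({u, v} : Finset V) ∈ X →
      edgeFunctional X f (orientedEdge X u v) = f u v := by
    intro u v huv h
    rw [orientedEdge_of_lt huv h]
    obtain ⟨e0, e1⟩ := orderEmbOfFin_pair huv rfl (Finset.card_pair huv.ne)
    simp only [edgeFunctional, Finsupp.linearCombination_single, one_smul]
    congr 1
  rcases lt_trichotomy u v with huv | rfl | huv
  · exact key huv h
  · have := hf u u
    rw [orientedEdge_self, map_zero]; linarith
  · rw [Finset.pair_comm] at h
    rw [orientedEdge_swap, map_neg, key huv h, hf v u]

theorem edgeFunctional_boundary {f : V → V → ℝ} (hf : ∀ u v, f v u = - f u v)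
    (hc : ∀ u v w, ({u, v, w} : Finset V) ∈ X → f u v + f v w = f u w) (b : Chains X 2) :
    edgeFunctional X f (boundary X 1 b) = 0 := by
  induction b using Finsupp.induction_linear with
  | zero => simp
  | add f g hf hg => rw [map_add, map_add, hf, hg, add_zero]
  | single σ a =>
    obtain ⟨u, v, w, huv, hvw, hσ⟩ := exists_eq_triple σ
    have h := σ.2.1
    have h2 : Finsupp.single σ a = a • Finsupp.single σ (1 : ℝ) := by simp
    have mu : u ∈ σ.1 := by rw [hσ]; simp
    have mv : v ∈ σ.1 := by rw [hσ]; simp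
    have mw : w ∈ σ.1 := by rw [hσ]; simp
    rw [h2, map_smul, map_smul, boundary_single_triple huv hvw σ hσ, map_add, map_sub,
      edgeFunctional_orientedEdge hf (pair_mem_of_subset h mv mw),
      edgeFunctional_orientedEdge hf (pair_mem_of_subset h mu mw),
      edgeFunctional_orientedEdge hf (pair_mem_of_subset h mu mv)]
    rw [hσ] at h
    rw [← hc u v w h]
    simp

end Chains

/-! ### Path distances and induction over balls -/

section PathCompletion

variable {X : Type*} {ω : Network X}

theorem pathCompletion_le_walk (m : ℕ) (p : Fin (m + 1) → X) :
    pathCompletion ω (p 0) (p (Fin.last m)) ≤ ∑ i : Fin m, ω (p i.castSucc) (p i.succ) :=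
  iInf_le_of_le m (iInf_le_of_le p (iInf_le_of_le rfl (iInf_le_of_le rfl le_rfl)))

theorem pathCompletion_self (x : X) : pathCompletion ω x x = 0 := by
  have := pathCompletion_le_walk (ω := ω) 0 (fun _ => x)
  simpa using this

theorem pathCompletion_le (x y : X) : pathCompletion ω x y ≤ ω x y := by
  have := pathCompletion_le_walk (ω := ω) 1 ![x, y]
  simpa using this

theorem le_pathCompletion_iff {x y : X} {c : ℝ≥0∞} :
    c ≤ pathCompletion ω x y ↔ ∀ (m : ℕ) (p : Fin (m + 1) → X), p 0 = x → p (Fin.last m) = y →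
      c ≤ ∑ i : Fin m, ω (p i.castSucc) (p i.succ) := by
  simp only [pathCompletion, le_iInf_iff]

theorem le_add_walk (F : X → ℝ≥0∞) (hF : ∀ y z, F z ≤ F y + ω y z) (m : ℕ)
    (p : Fin (m + 1) → X) :
    F (p (Fin.last m)) ≤ F (p 0) + ∑ i : Fin m, ω (p i.castSucc) (p i.succ) := by
  induction m with
  | zero => simp
  | succ m ih =>
    have h1 := ih (fun i => p i.castSucc)
    rw [Fin.sum_univ_castSucc, ← add_assoc]
    exact (hF _ _).trans (add_le_add_left h1 _)

/-- A function growing by at most `ω y z` along each edge grows by at most the path distance. -/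
theorem le_add_pathCompletion (F : X → ℝ≥0∞) (hF : ∀ y z, F z ≤ F y + ω y z) (x y : X) :
    F y ≤ F x + pathCompletion ω x y := by
  rw [← tsub_le_iff_left, le_pathCompletion_iff]
  rintro m p rfl rfl
  rw [tsub_le_iff_left]
  exact le_add_walk F hF m p

theorem le_walk_add (F : X → ℝ≥0∞) (hF : ∀ y z, F y ≤ ω y z + F z) (m : ℕ)
    (p : Fin (m + 1) → X) :
    F (p 0) ≤ (∑ i : Fin m, ω (p i.castSucc) (p i.succ)) + F (p (Fin.last m)) := by
  induction m with
  | zero => simp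
  | succ m ih =>
    have h1 := ih (fun i => p i.castSucc)
    rw [Fin.sum_univ_castSucc]
    exact (h1.trans (add_le_add_right (hF _ _) _)).trans_eq (add_assoc _ _ _).symm

/-- A function decreasing by at most `ω y z` along each edge decreases by at most the path
distance. -/
theorem le_pathCompletion_add (F : X → ℝ≥0∞) (hF : ∀ y z, F y ≤ ω y z + F z) (x y : X) :
    F x ≤ pathCompletion ω x y + F y := by
  rw [← tsub_le_iff_right, le_pathCompletion_iff]
  rintro m p rfl rfl
  rw [tsub_le_iff_right]
  exact le_walk_add F hF m p

theorem pathCompletion_le_add_edge (x y z : X) :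
    pathCompletion ω x z ≤ pathCompletion ω x y + ω y z := by
  rw [← tsub_le_iff_right, le_pathCompletion_iff]
  rintro m p rfl rfl
  rw [tsub_le_iff_right]
  have := pathCompletion_le_walk (ω := ω) (m + 1) (Fin.snoc (α := fun _ => X) p z)
  rw [Fin.sum_univ_castSucc] at this
  have h0 : (Fin.snoc (α := fun _ => X) p z : Fin (m + 1 + 1) → X) 0 = p 0 := by
    rw [← Fin.castSucc_zero, Fin.snoc_castSucc]
  simpa only [Fin.snoc_castSucc, Fin.succ_castSucc, Fin.snoc_last, Fin.succ_last, h0] using this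

theorem pathCompletion_triangle (x y z : X) :
    pathCompletion ω x z ≤ pathCompletion ω x y + pathCompletion ω y z :=
  le_add_pathCompletion _ (pathCompletion_le_add_edge x) y z

/-- Finite distances do not leave a set that is closed under finite edges. -/
theorem mem_of_pathCompletion_lt_top {U : Set X} (hU : ∀ y z, y ∈ U → ω y z < ∞ → z ∈ U) {x y : X}
    (hx : x ∈ U) (h : pathCompletion ω x y < ∞) : y ∈ U := by
  classical
  by_contra hy
  -- The function that is `0` on `U` and `∞` off it.
  have := le_add_pathCompletion (ω := ω) (fun v => if v ∈ U then 0 else ∞) (by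
    intro y z
    by_cases hy : y ∈ U
    · by_cases hz : z ∈ U
      · simp [hz]
      · have : ω y z = ∞ := by
          by_contra hne
          exact hz (hU y z hy (lt_top_iff_ne_top.mpr hne))
        simp [this]
    · simp [hy]) x y
  simp only [hx, hy, if_true, if_false, zero_add, top_le_iff] at this
  exact h.ne this

/-- If finite edges leave `U` only at `v`, then `v` is at least as close to any point outside `U` as
the points of `U` are. -/
theorem pathCompletion_le_of_exit {U : Set X} {v : X}
    (hU : ∀ y z, y ∈ U → z ∉ U → ω y z < ∞ → y = v) {x s : X} (hx : x ∈ U) (hs : s ∉ U) :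
    pathCompletion ω v s ≤ pathCompletion ω x s := by
  classical
  have hd : ∀ y z, pathCompletion ω y s ≤ ω y z + pathCompletion ω z s := fun y z =>
    (pathCompletion_triangle y z s).trans (add_le_add_left (pathCompletion_le y z) _)
  -- The distance to `s` truncated at `d(v,s)` off `U`, and constantly `d(v,s)` on `U`: it can only
  -- drop on leaving `U`, which happens at `v`.
  have := le_pathCompletion_add (ω := ω) (fun y => if y ∈ U then pathCompletion ω v s else
    min (pathCompletion ω y s) (pathCompletion ω v s)) (by
    intro y z
    by_cases hy : y ∈ U <;> by_cases hz : z ∈ U <;> simp only [hy, hz, if_true, if_false]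
    · exact le_add_self
    · by_cases ht : ω y z < ∞
      · obtain rfl := hU y z hy hz ht
        rw [min_def]
        split_ifs
        · exact hd y z
        · exact le_add_self
      · rw [not_lt_top_iff.mp ht]; simp
    · exact (min_le_right _ _).trans le_add_self
    · rw [min_def (pathCompletion ω z s)]
      split_ifs
      · exact (min_le_left _ _).trans (hd y z)
      · exact (min_le_right _ _).trans le_add_self) x s
  simpa [hx, hs, pathCompletion_self] using this

/-- `ε` is the least value of `g` above `δ`, or `∞` if there is none; the latter is why `δ` must be
finite. -/
theorem exists_gt_forall_lt_imp_le {ι : Type*} [Finite ι] (g : ι → ℝ≥0∞) {δ : ℝ≥0∞} (hδ : δ < ∞) :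
    ∃ ε, δ < ε ∧ ∀ i, g i < ε → g i ≤ δ := by
  classical
  cases nonempty_fintype ι
  refine ⟨(Finset.univ.filter fun i => δ < g i).inf g, ?_, ?_⟩
  · rw [Finset.lt_inf_iff hδ]
    simp
  · intro i hi
    by_contra hlt
    exact absurd hi (not_lt.mpr (Finset.inf_le (by simpa using hlt)))

/-- Induction over the points of a ball, along edges between points of the ball. -/
theorem ball_induction [Finite X] {δ : ℝ≥0∞} (hδ : δ < ∞) {x : X} (Q : X → Prop) (h0 : Q x)
    (step : ∀ y z, pathCompletion ω x y ≤ δ → pathCompletion ω x z ≤ δ → ω y z ≤ δ → Q y → Q z)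
    {y : X} (hy : pathCompletion ω x y ≤ δ) : Q y := by
  -- The infimum defining the distance need not be shown to be attained: a walk of total weight
  -- below `ε₁` and `ε₂` has all its edges and all distances from `x` to its vertices already at
  -- most `δ`.
  obtain ⟨ε₁, h1, h1'⟩ := exists_gt_forall_lt_imp_le (fun p : X × X => ω p.1 p.2) hδ
  obtain ⟨ε₂, h2, h2'⟩ :=
    exists_gt_forall_lt_imp_le (fun p : X × X => pathCompletion ω p.1 p.2) hδ
  have key : ∀ (m : ℕ) (p : Fin (m + 1) → X), p 0 = x →
      ∑ i : Fin m, ω (p i.castSucc) (p i.succ) < min ε₁ ε₂ → Q (p (Fin.last m)) := by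
    intro m
    induction m with
    | zero => intro p hp _; simpa [hp] using h0
    | succ m ih =>
      intro p hp hlt
      have hd := pathCompletion_le_walk (ω := ω) (m + 1) p
      have hd' := pathCompletion_le_walk (ω := ω) m (fun i => p i.castSucc)
      have hlt' := hlt
      rw [Fin.sum_univ_castSucc] at hlt
      have hp' : p (Fin.castSucc 0) = x := by simpa using hp
      rw [hp'] at hd'
      rw [hp] at hd
      have hpre := lt_of_le_of_lt le_self_add hlt
      have hw := lt_of_le_of_lt le_add_self hlt
      refine step (p (Fin.last m).castSucc) _ ?_ ?_ ?_ (ih (fun i => p i.castSucc) hp' hpre)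
      · exact h2' (x, _) ((hd'.trans_lt hpre).trans_le (min_le_right _ _))
      · exact h2' (x, _) ((hd.trans_lt hlt').trans_le (min_le_right _ _))
      · exact h1' (_, _) (hw.trans_le (min_le_left _ _))
  have hlt : pathCompletion ω x y < min ε₁ ε₂ := hy.trans_lt (lt_min h1 h2)
  simp only [pathCompletion, iInf_lt_iff] at hlt
  obtain ⟨m, p, hp, rfl, hlt⟩ := hlt
  exact key m p hp hlt

end PathCompletion

/-! ### Positions on the cycle -/

section Position

variable {n : ℕ} [NeZero n]

/-- The position of `i` on the cycle, counted from `k` in the positive direction. -/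
def cyclePos (k i : Fin n) : ℕ := (i - k).val

theorem cyclePos_lt (k i : Fin n) : cyclePos k i < n := (i - k).isLt

theorem cyclePos_self (k : Fin n) : cyclePos k k = 0 := by simp [cyclePos]

theorem cyclePos_injective (k : Fin n) : Function.Injective (cyclePos k) := by
  intro i j h
  have := Fin.ext h
  simpa using this

theorem cyclePos_add_one (hn : 2 ≤ n) (k i : Fin n) :
    (cyclePos k i + 1 < n ∧ cyclePos k (i + 1) = cyclePos k i + 1) ∨
      (cyclePos k i + 1 = n ∧ cyclePos k (i + 1) = 0) := by
  have h : i + 1 - k = (i - k) + 1 := by abel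
  have h1 : ((1 : Fin n) : ℕ) = 1 := by
    rw [Fin.val_one', Nat.mod_eq_of_lt (by omega)]
  have hlt := (i - k).isLt
  unfold cyclePos
  rw [h, Fin.val_add, h1]
  rcases Nat.lt_or_ge ((i - k).val + 1) n with h2 | h2
  · left; exact ⟨h2, Nat.mod_eq_of_lt h2⟩
  · right
    have : (i - k).val + 1 = n := by omega
    exact ⟨this, by rw [this, Nat.mod_self]⟩

end Position

/-! ### Arcs between the source and the sink -/

/-- A set of vertices which finite edges enter only from `k` and leave only to `s`, and along which
edges raise the rank `r` by one. -/
structure IsArc {X : Type*} (ω : Network X) (k s : X) (A : Finset X) (r : X → ℕ) : Prop where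
  source_notMem : k ∉ A
  sink_notMem : s ∉ A
  mem_or_eq_sink : ∀ y z, y ∈ A → y ≠ z → ω y z < ∞ → z ∈ A ∨ z = s
  rank_eq : ∀ y z, y ∈ A → y ≠ z → ω y z < ∞ → r z = r y + 1
  mem_or_eq_source : ∀ y z, z ∈ A → y ≠ z → ω y z < ∞ → y ∈ A ∨ y = k
  rank_inj : ∀ y ∈ A, ∀ z ∈ A, r y = r z → y = z
  rank_lt : ∀ v ∈ A, r v < r s

namespace IsArc

variable {X : Type*} {ω : Network X} {k s : X} {A : Finset X} {r : X → ℕ}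

/-- The complement of `A ∪ {k}` is closed under finite edges: `A` is entered only from `k`, and `k`
is not entered at all. -/
theorem mem_or_eq_source_of_pathCompletion (h : IsArc ω k s A r) (hk : IsSource ω k) {x v : X}
    (hv : v ∈ A) (hd : pathCompletion ω x v < ∞) : x ∈ A ∨ x = k := by
  by_contra hx
  rw [not_or] at hx
  refine (mem_of_pathCompletion_lt_top (U := {y | y ∉ A ∧ y ≠ k}) ?_ hx hd).1 hv
  rintro y z ⟨hyA, hyk⟩ hyz
  refine ⟨fun hz => ?_, ?_⟩
  · have hne : y ≠ z := by rintro rfl; exact hyA hz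
    rcases h.mem_or_eq_source y z hz hne hyz with h1 | h1
    exacts [hyA h1, hyk h1]
  · rintro rfl
    exact hyz.ne (hk y hyk)

theorem mem_or_eq_sink_of_pathCompletion (h : IsArc ω k s A r) (hs : IsSink ω s) {x v : X}
    (hx : x ∈ A) (hd : pathCompletion ω x v < ∞) : (v ∈ A ∧ r x ≤ r v) ∨ v = s := by
  refine mem_of_pathCompletion_lt_top (U := {y | (y ∈ A ∧ r x ≤ r y) ∨ y = s}) ?_
    (Or.inl ⟨hx, le_rfl⟩) hd
  rintro y z (⟨hy, hr⟩ | rfl) hyz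
  · rcases eq_or_ne y z with rfl | hne
    · exact Or.inl ⟨hy, hr⟩
    · rcases h.mem_or_eq_sink y z hy hne hyz with hz | rfl
      · exact Or.inl ⟨hz, by have := h.rank_eq y z hy hne hyz; omega⟩
      · exact Or.inr rfl
  · rcases eq_or_ne z y with rfl | hne
    · exact Or.inr rfl
    · exact absurd (hs z hne) hyz.ne

/-- Ranks increase by one and are injective on `A`, so a path from `x` can leave the part of rank at
most `r v` only at `v`. -/
theorem pathCompletion_sink_le (h : IsArc ω k s A r) {x v : X} (hx : x ∈ A) (hv : v ∈ A)
    (hr : r x ≤ r v) : pathCompletion ω v s ≤ pathCompletion ω x s := by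
  refine pathCompletion_le_of_exit (U := {y | y ∈ A ∧ r y ≤ r v}) ?_ ⟨hx, hr⟩
    (fun hs => h.sink_notMem hs.1)
  rintro y z ⟨hy, hyr⟩ hz hyz
  have hne : y ≠ z := by rintro rfl; exact hz ⟨hy, hyr⟩
  have h1 := h.rank_eq y z hy hne hyz
  apply h.rank_inj y hy v hv
  rcases h.mem_or_eq_sink y z hy hne hyz with hzA | rfl
  · by_contra hne'
    exact hz ⟨hzA, by omega⟩
  · have := h.rank_lt v hv
    omega

end IsArc

/-! ### Orientation of the cycle: source, sink and the two arcs -/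

/-- The edges of the cycle point away from `k` and towards `s`. -/
structure IsBipath {n : ℕ} [NeZero n] (ω : Network (Fin n)) (k s : Fin n) : Prop where
  pos : 0 < cyclePos k s
  lt_top_of_lt : ∀ i, cyclePos k i < cyclePos k s → ω i (i + 1) < ∞
  lt_top_of_le : ∀ i, cyclePos k s ≤ cyclePos k i → ω (i + 1) i < ∞

section Cycle

variable {n : ℕ} [NeZero n] {ω : Network (Fin n)} {k s : Fin n}

theorem IsBipath.edge (hG : IsCycleNetwork ω) (hb : IsBipath ω k s) {x y : Fin n} (hne : x ≠ y)
    (h : ω x y < ∞) :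
    (y = x + 1 ∧ cyclePos k x < cyclePos k s) ∨ (x = y + 1 ∧ cyclePos k s ≤ cyclePos k y) := by
  rcases (hG.edge_iff x y hne).1 (Or.inl h) with rfl | rfl
  · refine Or.inl ⟨rfl, ?_⟩
    by_contra hlt
    exact hG.oriented _ _ hne ⟨h, hb.lt_top_of_le _ (not_lt.mp hlt)⟩
  · refine Or.inr ⟨rfl, ?_⟩
    by_contra hlt
    exact hG.oriented _ _ hne ⟨h, hb.lt_top_of_lt _ (not_le.mp hlt)⟩

theorem mem_arcPos {i : Fin n} :
    i ∈ arcPos k s ↔ 0 < cyclePos k i ∧ cyclePos k i < cyclePos k s := by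
  simp [arcPos, cyclePos]

theorem mem_arcNeg {i : Fin n} : i ∈ arcNeg k s ↔ cyclePos k s < cyclePos k i := by
  simp [arcNeg, cyclePos]

theorem IsBipath.isArc_arcPos (hn : 3 ≤ n) (hG : IsCycleNetwork ω) (hb : IsBipath ω k s) :
    IsArc ω k s (arcPos k s) (cyclePos k) := by
  have h2 : 2 ≤ n := by omega
  have hk := cyclePos_self k
  have hp := hb.pos
  have heq : ∀ y z : Fin n, cyclePos k y = cyclePos k z → y = z := fun _ _ h =>
    cyclePos_injective k h
  constructor
  · simp [mem_arcPos, hk]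
  · simp [mem_arcPos]
  · intro y z hy hne hyz
    rw [mem_arcPos] at hy ⊢
    have := heq z s
    rcases hb.edge hG hne hyz with ⟨rfl, h⟩ | ⟨rfl, h⟩
    · have := cyclePos_add_one h2 k y; have := cyclePos_lt k s; grind
    · have := cyclePos_add_one h2 k z; grind
  · intro y z hy hne hyz
    rw [mem_arcPos] at hy
    rcases hb.edge hG hne hyz with ⟨rfl, h⟩ | ⟨rfl, h⟩
    · have := cyclePos_add_one h2 k y; have := cyclePos_lt k s; grind
    · have := cyclePos_add_one h2 k z; grind
  · intro y z hz hne hyz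
    rw [mem_arcPos] at hz ⊢
    have := heq y k
    rcases hb.edge hG hne hyz with ⟨rfl, h⟩ | ⟨rfl, h⟩
    · have := cyclePos_add_one h2 k y; grind
    · have := cyclePos_add_one h2 k z; grind
  · exact fun y _ z _ => heq y z
  · intro v hv
    exact (mem_arcPos.mp hv).2

/-- On this arc edges lower the position, hence the reversed rank `n - cyclePos k i`. -/
theorem IsBipath.isArc_arcNeg (hn : 3 ≤ n) (hG : IsCycleNetwork ω) (hb : IsBipath ω k s) :
    IsArc ω k s (arcNeg k s) (fun i => n - cyclePos k i) := by
  have h2 : 2 ≤ n := by omega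
  have hk := cyclePos_self k
  have hp := hb.pos
  have hlt := cyclePos_lt k
  have heq : ∀ y z : Fin n, cyclePos k y = cyclePos k z → y = z := fun _ _ h =>
    cyclePos_injective k h
  constructor
  · simp [mem_arcNeg, hk]
  · simp [mem_arcNeg]
  · intro y z hy hne hyz
    rw [mem_arcNeg] at hy ⊢
    have := heq z s
    rcases hb.edge hG hne hyz with ⟨rfl, h⟩ | ⟨rfl, h⟩
    · grind
    · have := cyclePos_add_one h2 k z; grind
  · intro y z hy hne hyz
    rw [mem_arcNeg] at hy
    have := hlt y
    have := hlt z
    rcases hb.edge hG hne hyz with ⟨rfl, h⟩ | ⟨rfl, h⟩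
    · grind
    · have := cyclePos_add_one h2 k z; grind
  · intro y z hz hne hyz
    rw [mem_arcNeg] at hz ⊢
    have := heq y k
    rcases hb.edge hG hne hyz with ⟨rfl, h⟩ | ⟨rfl, h⟩
    · have := cyclePos_add_one h2 k y; grind
    · have := cyclePos_add_one h2 k z; grind
  · intro y _ z _ h
    have := hlt y
    have := hlt z
    exact heq y z (by omega)
  · intro v hv
    rw [mem_arcNeg] at hv
    have := hlt v
    show n - _ < n - _
    omega

theorem IsBipath.isSink (hn : 3 ≤ n) (hG : IsCycleNetwork ω) (hb : IsBipath ω k s) (v : Fin n) :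
    IsSink ω v ↔ v = s := by
  have h2 : 2 ≤ n := by omega
  have hp := hb.pos
  constructor
  · intro hv
    by_contra hne
    rcases lt_or_ge (cyclePos k v) (cyclePos k s) with h | h
    · have h1 := hb.lt_top_of_lt v h
      have hne1 : v + 1 ≠ v := by
        intro he
        have := cyclePos_add_one h2 k v
        rw [he] at this; omega
      exact h1.ne (hv _ hne1)
    · have hlt : cyclePos k s < cyclePos k v :=
        lt_of_le_of_ne h fun he => hne (cyclePos_injective k he.symm)
      have h3 := cyclePos_add_one h2 k (v - 1)
      rw [sub_add_cancel] at h3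
      have h1 := hb.lt_top_of_le (v - 1) (by omega)
      rw [sub_add_cancel] at h1
      have hne1 : v - 1 ≠ v := by
        intro he
        rw [he] at h3; omega
      exact h1.ne (hv _ hne1)
  · rintro rfl u hu
    by_contra hne
    rcases hb.edge hG hu.symm (lt_top_iff_ne_top.mpr hne) with ⟨_, h⟩ | ⟨h, h'⟩
    · omega
    · have := cyclePos_add_one h2 k u
      rw [← h] at this
      omega

theorem IsBipath.isSource (hn : 3 ≤ n) (hG : IsCycleNetwork ω) (hb : IsBipath ω k s) :
    IsSource ω k := by
  intro u hu
  by_contra hne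
  have h2 : 2 ≤ n := by omega
  have hk := cyclePos_self k
  have := cyclePos_lt k s
  rcases hb.edge hG hu (lt_top_iff_ne_top.mpr hne) with ⟨h, h'⟩ | ⟨h, h'⟩
  · have := cyclePos_add_one h2 k u
    rw [← h] at this
    omega
  · have := hb.pos
    omega

/-- If every vertex of an inconsistently oriented cycle network is reached from `k`, then all edges
point away from `k` and towards some other vertex. -/
theorem exists_isBipath (hn : 3 ≤ n) (hG : IsCycleNetwork ω) (hinc : ¬ IsConsistentlyOriented ω)
    (hk : ∀ v, pathCompletion ω k v < ∞) :
    (∀ v, IsSource ω v → v = k) ∧ ∃ s, IsBipath ω k s := by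
  have h2 : 2 ≤ n := by omega
  have hsrc : ∀ v, IsSource ω v → v = k := by
    intro v hv
    by_contra hne
    refine mem_of_pathCompletion_lt_top (ω := ω) (U := {y | y ≠ v}) ?_ (Ne.symm hne) (hk v) rfl
    rintro y z hy hyz rfl
    exact hyz.ne (hv y hy)
  refine ⟨hsrc, ?_⟩
  have hne : ∀ i : Fin n, i ≠ i + 1 := by
    intro i he
    have := cyclePos_add_one h2 k i
    rw [← he] at this; omega
  have hor : ∀ i, ω i (i + 1) < ∞ ∨ ω (i + 1) i < ∞ := fun i =>
    (hG.edge_iff i (i + 1) (hne i)).2 (Or.inl rfl)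
  -- If the edge behind `i + 1` also pointed away from it, `i + 1` would be a second source.
  have hstep : ∀ i, i + 1 ≠ k → ω (i + 1) (i + 1 + 1) < ∞ → ω i (i + 1) < ∞ := by
    intro i hik h
    by_contra hi
    have hi' := (hor i).resolve_left hi
    apply hik
    apply hsrc
    intro u hu
    by_contra hfin
    rw [← ne_eq, ← lt_top_iff_ne_top] at hfin
    rcases (hG.edge_iff u (i + 1) hu).1 (Or.inl hfin) with he | rfl
    · rw [add_left_inj] at he
      subst he
      exact hi hfin
    · exact hG.oriented _ _ (hne (i + 1)) ⟨h, hfin⟩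
  have hdown : ∀ (j : ℕ) (i i' : Fin n), cyclePos k i' = cyclePos k i + j →
      ω i' (i' + 1) < ∞ → ω i (i + 1) < ∞ := by
    intro j
    induction j with
    | zero =>
      intro i i' h
      rw [cyclePos_injective k h]
      exact id
    | succ j ih =>
      intro i i' h hi'
      have h3 := cyclePos_add_one h2 k (i' - 1)
      rw [sub_add_cancel] at h3
      refine ih i (i' - 1) (by omega) (hstep _ ?_ ?_)
      · rw [sub_add_cancel]
        rintro rfl
        rw [cyclePos_self] at h; omega
      · rwa [sub_add_cancel]
  have hex : ∃ j, ∃ i, cyclePos k i = j ∧ ¬ ω i (i + 1) < ∞ := by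
    by_contra hno
    push Not at hno
    exact hinc (Or.inl fun i => hno _ i rfl)
  classical
  -- By `hdown` the positively directed edges form an initial segment counted from `k`; `s` is where
  -- it ends.
  obtain ⟨s, hs, hs'⟩ := Nat.find_spec hex
  refine ⟨s, ?_, ?_, ?_⟩
  · by_contra h0
    refine hinc (Or.inr fun i => (hor i).resolve_left fun hi => hs' ?_)
    exact hdown (cyclePos k i) s i (by omega) hi
  · intro i hi
    rw [hs] at hi
    by_contra hc
    exact Nat.find_min hex hi ⟨i, rfl, hc⟩
  · intro i hi
    refine (hor i).resolve_left fun h => hs' ?_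
    exact hdown (cyclePos k i - cyclePos k s) s i (by omega) h

end Cycle

/-! ### Reduction of Dowker cycles to network edges -/

section Dowker

variable {X : Type*} [LinearOrder X] {ω : Network X} {δ : ℝ≥0∞}

theorem mem_dowkerFiltration {σ : Finset X} :
    σ ∈ dowkerFiltration ω δ ↔ σ.Nonempty ∧ ∃ x, ∀ y ∈ σ, pathCompletion ω x y ≤ δ :=
  Iff.rfl

theorem singleton_mem_dowkerFiltration (v : X) : ({v} : Finset X) ∈ dowkerFiltration ω δ :=
  mem_dowkerFiltration.2 ⟨by simp, v, by simp [pathCompletion_self]⟩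

theorem orientedEdge_ball {x u v : X} (hu : pathCompletion ω x u ≤ δ)
    (hv : pathCompletion ω x v ≤ δ) :
    orientedEdge (dowkerFiltration ω δ) x u + orientedEdge (dowkerFiltration ω δ) u v -
      orientedEdge (dowkerFiltration ω δ) x v ∈ boundaries (dowkerFiltration ω δ) 1 :=
  orientedEdge_triangle <| mem_dowkerFiltration.2
    ⟨by simp, x, by simp [pathCompletion_self, hu, hv]⟩

theorem cycles_le_boundaries_of_forall_le (x : X) (h : ∀ v, pathCompletion ω x v ≤ δ) :
    cycles (dowkerFiltration ω δ) 1 ≤ boundaries (dowkerFiltration ω δ) 1 := by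
  refine cycles_one_le_of_potential _ (orientedEdge _ x) fun u v _ => ?_
  convert orientedEdge_ball (h u) (h v) using 1
  abel

/-- Induction step along a path inside the ball of `x`: the triangle `x, y, z` is a (possibly
degenerate) simplex. -/
theorem potential_extend {M : Submodule ℝ (Chains (dowkerFiltration ω δ) 1)}
    (hM : boundaries (dowkerFiltration ω δ) 1 ≤ M) {S : X → Chains (dowkerFiltration ω δ) 1}
    {x y z : X} (hy : pathCompletion ω x y ≤ δ) (hz : pathCompletion ω x z ≤ δ)
    (h1 : orientedEdge (dowkerFiltration ω δ) x y - (S y - S x) ∈ M)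
    (h2 : orientedEdge (dowkerFiltration ω δ) y z - (S z - S y) ∈ M) :
    orientedEdge (dowkerFiltration ω δ) x z - (S z - S x) ∈ M := by
  convert sub_mem (add_mem h1 h2) (hM (orientedEdge_ball hy hz)) using 1
  abel

/-- A potential for the edges of the network modulo `M ≥ B₁` forces all `1`-cycles into `M`. -/
theorem cycles_le_of_network_potential [Finite X] (hδ : δ < ∞)
    {M : Submodule ℝ (Chains (dowkerFiltration ω δ) 1)}
    (hM : boundaries (dowkerFiltration ω δ) 1 ≤ M) (S : X → Chains (dowkerFiltration ω δ) 1)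
    (hS : ∀ y z, y ≠ z → ω y z ≤ δ →
      orientedEdge (dowkerFiltration ω δ) y z - (S z - S y) ∈ M) :
    cycles (dowkerFiltration ω δ) 1 ≤ M := by
  have key : ∀ x v, pathCompletion ω x v ≤ δ →
      orientedEdge (dowkerFiltration ω δ) x v - (S v - S x) ∈ M := by
    intro x v hv
    refine ball_induction hδ
      (fun v => orientedEdge (dowkerFiltration ω δ) x v - (S v - S x) ∈ M)
      (by simp [orientedEdge_self]) ?_ hv
    intro y z hy hz hyz ih
    rcases eq_or_ne y z with rfl | hne
    · exact ih
    · exact potential_extend hM hy hz ih (hS y z hne hyz)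
  refine cycles_one_le_of_potential M S fun u v huv => ?_
  obtain ⟨-, x, hx⟩ := mem_dowkerFiltration.1 huv
  have hu := hx u (by simp)
  have hv := hx v (by simp)
  -- With witness `x`, the edge `[u,v]` is homologous to `[x,v] - [x,u]`.
  convert add_mem (sub_mem (key x v hv) (key x u hu)) (hM (orientedEdge_ball hu hv)) using 1
  abel

/-- A short path from `k` to `s` may use the other arc. Passing through `i ∈ A` forces both pieces,
`k` to `i` and `i` to `s`, to stay on this one, where `S` is an exact potential. -/
theorem IsArc.orientedEdge_sub_mem [Finite X] {k s : X} {A : Finset X} {r : X → ℕ}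
    (h : IsArc ω k s A r) (hs : IsSink ω s) (hδ : δ < ∞)
    (S : X → Chains (dowkerFiltration ω δ) 1)
    (hS : ∀ y z, y ≠ z → ω y z ≤ δ → (y ∈ A ∨ y = k) ∧ (z ∈ A ∨ z = k) ∨
      (y ∈ A ∨ y = s) ∧ (z ∈ A ∨ z = s) →
      orientedEdge (dowkerFiltration ω δ) y z = S z - S y)
    {i : X} (hi : i ∈ A) (hks : pathCompletion ω k s ≤ δ) (hki : pathCompletion ω k i ≤ δ)
    (his : pathCompletion ω i s ≤ δ) :
    orientedEdge (dowkerFiltration ω δ) k s - (S s - S k) ∈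
      boundaries (dowkerFiltration ω δ) 1 := by
  have h1 : i ∈ A → orientedEdge (dowkerFiltration ω δ) k i - (S i - S k) ∈
      boundaries (dowkerFiltration ω δ) 1 := by
    -- The condition `z ∈ A` makes the claim vacuous for vertices of the ball off the arc.
    refine ball_induction hδ (fun z => z ∈ A → orientedEdge (dowkerFiltration ω δ) k z -
      (S z - S k) ∈ boundaries (dowkerFiltration ω δ) 1)
      (fun hk => absurd hk h.source_notMem) ?_ hki
    intro y z hy hz hyz ih hzA
    rcases eq_or_ne y z with rfl | hne
    · exact ih hzA
    have hyA := h.mem_or_eq_source y z hzA hne (hyz.trans_lt hδ)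
    have he := hS y z hne hyz (Or.inl ⟨hyA, Or.inl hzA⟩)
    refine potential_extend le_rfl hy hz ?_ (by simp [he])
    rcases hyA with hyA | rfl
    · exact ih hyA
    · simp [orientedEdge_self]
  have h2 : (s ∈ A ∨ s = s) ∧ orientedEdge (dowkerFiltration ω δ) i s - (S s - S i) ∈
      boundaries (dowkerFiltration ω δ) 1 := by
    refine ball_induction hδ (fun z => (z ∈ A ∨ z = s) ∧
      orientedEdge (dowkerFiltration ω δ) i z - (S z - S i) ∈
        boundaries (dowkerFiltration ω δ) 1) ⟨Or.inl hi, by simp [orientedEdge_self]⟩ ?_ his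
    rintro y z hy hz hyz ⟨hyA, ih⟩
    rcases eq_or_ne y z with rfl | hne
    · exact ⟨hyA, ih⟩
    rcases hyA with hyA | rfl
    · have hzA := h.mem_or_eq_sink y z hyA hne (hyz.trans_lt hδ)
      have he := hS y z hne hyz (Or.inr ⟨Or.inl hyA, hzA⟩)
      exact ⟨hzA, potential_extend le_rfl hy hz ih (by simp [he])⟩
    · exact absurd (hs z hne.symm) (hyz.trans_lt hδ).ne
  exact potential_extend le_rfl hki hks (h1 hi) h2.2

theorem exists_of_arcValue_le {d : Network X} {k s : X} {A : Finset X} (hA : A.Nonempty)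
    (h : arcValue d k s A ≤ δ) : ∃ i ∈ A, d k s ≤ δ ∧ d k i ≤ δ ∧ d i s ≤ δ := by
  rw [arcValue, dif_pos hA, Finset.inf'_le_iff] at h
  simpa using h

theorem not_le_of_lt_arcValue {d : Network X} {k s : X} {A : Finset X} (h : δ < arcValue d k s A)
    {i : X} (hi : i ∈ A) (hks : d k s ≤ δ) (hki : d k i ≤ δ) : δ < d i s := by
  have hA : A.Nonempty := ⟨i, hi⟩
  rw [arcValue, dif_pos hA] at h
  have := h.trans_le (Finset.inf'_le _ hi)
  simpa [hks.not_gt, hki.not_gt] using this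

end Dowker

/-! ### Partial sums around a cut cycle -/

section CutPotential

variable {n : ℕ} [NeZero n] {M : Type*} [AddCommGroup M]

/-- The partial sums of `c` around the cycle `Fin n`, cut at the edge from `m` to `m + 1`. -/
def cutPotential (c : Fin n → M) (m i : Fin n) : M :=
  (∑ t ∈ Finset.univ.filter (· < i), c t) - if m < i then ∑ t, c t else 0

/-- Plain partial sums drop by the total at the wrap-around from `n - 1` to `0`; the correction term
moves this drop to the step from `m` to `m + 1`. -/
theorem cutPotential_add_one_sub (hn : 2 ≤ n) (c : Fin n → M) (m i : Fin n) :
    cutPotential c m (i + 1) - cutPotential c m i = c i - if i = m then ∑ t, c t else 0 := by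
  have h1 : ((1 : Fin n) : ℕ) = 1 := by rw [Fin.val_one', Nat.mod_eq_of_lt (by omega)]
  have hv : ((i + 1 : Fin n) : ℕ) = (i.val + 1) % n := by rw [Fin.val_add, h1]
  have hi := i.isLt
  have hm := m.isLt
  have hins : ∑ t ∈ insert i (Finset.univ.filter (· < i)), c t =
      c i + ∑ t ∈ Finset.univ.filter (· < i), c t := Finset.sum_insert (by simp)
  unfold cutPotential
  rcases Nat.lt_or_ge (i.val + 1) n with h | h
  · rw [Nat.mod_eq_of_lt h] at hv
    have hf : Finset.univ.filter (· < i + 1) = insert i (Finset.univ.filter (· < i)) := by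
      ext t
      simp only [Finset.mem_filter, Finset.mem_univ, true_and, Finset.mem_insert, Fin.lt_def, hv,
        Fin.ext_iff]
      omega
    rw [hf, hins]
    rcases lt_trichotomy m.val i.val with h2 | h2 | h2
    · have a1 : m < i + 1 := by rw [Fin.lt_def]; omega
      have a2 : m < i := by rw [Fin.lt_def]; omega
      have a3 : i ≠ m := by rw [ne_eq, Fin.ext_iff]; omega
      simp only [a1, a2, a3, if_true, if_false]; abel
    · have a1 : m < i + 1 := by rw [Fin.lt_def]; omega
      have a2 : ¬ m < i := by rw [Fin.lt_def]; omega
      have a3 : i = m := by rw [Fin.ext_iff]; omega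
      rw [if_pos a1, if_neg a2, if_pos a3]; abel
    · have a1 : ¬ m < i + 1 := by rw [Fin.lt_def]; omega
      have a2 : ¬ m < i := by rw [Fin.lt_def]; omega
      have a3 : i ≠ m := by rw [ne_eq, Fin.ext_iff]; omega
      simp only [a1, a2, a3, if_false]; abel
  · have hin : i.val + 1 = n := by omega
    rw [hin, Nat.mod_self] at hv
    have hf0 : Finset.univ.filter (· < i + 1) = ∅ := by
      ext t
      simp only [Finset.mem_filter, Finset.mem_univ, true_and, Fin.lt_def, hv]
      simp
    have hf : (Finset.univ : Finset (Fin n)) = insert i (Finset.univ.filter (· < i)) := by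
      ext t
      have ht := t.isLt
      have : t = i ∨ t < i := by rw [Fin.ext_iff, Fin.lt_def]; omega
      simpa using this
    have hsum : ∑ t, c t = c i + ∑ t ∈ Finset.univ.filter (· < i), c t := by
      rw [← hins, ← hf]
    have a1 : ¬ m < i + 1 := by rw [Fin.lt_def]; omega
    rw [hf0, hsum, if_neg a1]
    rcases eq_or_ne i m with rfl | h2
    · simp
    · have a2 : m < i := by rw [Fin.lt_def]; rw [ne_eq, Fin.ext_iff] at h2; omega
      rw [if_pos a2, if_neg h2]; simp

/-- Cutting after `s` leaves the positive way from `k` to `s`, cutting after `k` the negative way;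
their difference goes once around. -/
theorem cutPotential_sub_sub (c : Fin n → M) {k s : Fin n} (hks : k ≠ s) :
    (cutPotential c s s - cutPotential c s k) - (cutPotential c k s - cutPotential c k k) =
      ∑ t, c t := by
  unfold cutPotential
  rcases lt_or_gt_of_ne hks with h | h
  · simp [h, h.not_gt]
  · simp [h, h.not_gt]

end CutPotential

/-! ### The fundamental chain: spanning, filling and detection -/

section Cycle

variable {n : ℕ} [NeZero n] {ω : Network (Fin n)} {δ : ℝ≥0∞} {k s : Fin n}

theorem add_one_ne_self (hn : 2 ≤ n) (i : Fin n) : i + 1 ≠ i := by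
  intro he
  have := cyclePos_add_one hn i i
  rw [he] at this; omega

theorem add_one_add_one_ne_self (hn : 3 ≤ n) (i : Fin n) : i + 1 + 1 ≠ i := by
  intro he
  have h1 := cyclePos_add_one (by omega) i i
  have h2 := cyclePos_add_one (by omega) i (i + 1)
  rw [he, cyclePos_self] at h2
  rw [cyclePos_self] at h1
  omega

theorem maxEdgeWeight_le_iff :
    maxEdgeWeight ω ≤ δ ↔ ∀ i, ω i (i + 1) ≤ δ ∨ ω (i + 1) i ≤ δ := by
  simp [maxEdgeWeight]

/-- The edge from `t` to `t + 1` as a chain, or `0` when its weight exceeds `δ`. -/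
def cycleEdge (ω : Network (Fin n)) (δ : ℝ≥0∞) (t : Fin n) : Chains (dowkerFiltration ω δ) 1 :=
  open Classical in
  if ω t (t + 1) ≤ δ ∨ ω (t + 1) t ≤ δ then orientedEdge (dowkerFiltration ω δ) t (t + 1) else 0

/-- The sum of all edges of weight at most `δ`, in the positive direction. -/
def fundamentalChain (ω : Network (Fin n)) (δ : ℝ≥0∞) : Chains (dowkerFiltration ω δ) 1 :=
  ∑ t, cycleEdge ω δ t

theorem orientedEdge_sub_cutPotential (hn : 3 ≤ n) (hG : IsCycleNetwork ω) (hδ : δ < ∞)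
    (m : Fin n) {y z : Fin n} (hne : y ≠ z) (hyz : ω y z ≤ δ) :
    orientedEdge (dowkerFiltration ω δ) y z -
        (cutPotential (cycleEdge ω δ) m z - cutPotential (cycleEdge ω δ) m y) =
      if y = m ∧ z = m + 1 then fundamentalChain ω δ
      else if z = m ∧ y = m + 1 then - fundamentalChain ω δ else 0 := by
  have h2 : 2 ≤ n := by omega
  rcases (hG.edge_iff y z hne).1 (Or.inl (hyz.trans_lt hδ)) with rfl | rfl
  · have hno : ¬ (y + 1 = m ∧ y = m + 1) := by
      rintro ⟨rfl, h⟩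
      exact add_one_add_one_ne_self hn y h.symm
    rw [cutPotential_add_one_sub h2, cycleEdge, if_pos (Or.inl hyz), if_neg hno]
    rcases eq_or_ne y m with rfl | hm
    · simp [fundamentalChain]
    · simp [hm]
  · have hno : ¬ (z + 1 = m ∧ z = m + 1) := by
      rintro ⟨rfl, h⟩
      exact add_one_add_one_ne_self hn z h.symm
    rw [← neg_sub (cutPotential _ _ (z + 1)), cutPotential_add_one_sub h2, cycleEdge,
      if_pos (Or.inr hyz), if_neg hno, orientedEdge_swap]
    rcases eq_or_ne z m with rfl | hm
    · simp only [if_true, true_and, fundamentalChain]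
      abel
    · simp [hm]

theorem cycles_le_sup_span_fundamentalChain (hn : 3 ≤ n) (hG : IsCycleNetwork ω) (hδ : δ < ∞) :
    cycles (dowkerFiltration ω δ) 1 ≤
      boundaries (dowkerFiltration ω δ) 1 ⊔ Submodule.span ℝ {fundamentalChain ω δ} := by
  refine cycles_le_of_network_potential hδ le_sup_left (cutPotential (cycleEdge ω δ) 0) ?_
  intro y z hne hyz
  apply Submodule.mem_sup_right
  rw [orientedEdge_sub_cutPotential hn hG hδ 0 hne hyz]
  have := Submodule.mem_span_singleton_self (R := ℝ) (fundamentalChain ω δ)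
  split_ifs
  exacts [this, neg_mem this, zero_mem _]

/-- Cutting at an edge heavier than `δ` leaves no discrepancy on the remaining edges. -/
theorem cycles_le_boundaries_of_lt_maxEdgeWeight (hn : 3 ≤ n) (hG : IsCycleNetwork ω)
    (hδ : δ < ∞) (h : ¬ maxEdgeWeight ω ≤ δ) :
    cycles (dowkerFiltration ω δ) 1 ≤ boundaries (dowkerFiltration ω δ) 1 := by
  rw [maxEdgeWeight_le_iff] at h
  push Not at h
  obtain ⟨m, hm1, hm2⟩ := h
  refine cycles_le_of_network_potential hδ le_rfl (cutPotential (cycleEdge ω δ) m) ?_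
  intro y z hne hyz
  rw [orientedEdge_sub_cutPotential hn hG hδ m hne hyz, if_neg, if_neg]
  · exact zero_mem _
  · rintro ⟨rfl, rfl⟩
    exact hm2.not_ge hyz
  · rintro ⟨rfl, rfl⟩
    exact hm1.not_ge hyz

theorem pair_mem_of_maxEdgeWeight_le (hmax : maxEdgeWeight ω ≤ δ) (t : Fin n) :
    ({t, t + 1} : Finset (Fin n)) ∈ dowkerFiltration ω δ := by
  refine mem_dowkerFiltration.2 ⟨by simp, ?_⟩
  rcases maxEdgeWeight_le_iff.1 hmax t with h | h
  · exact ⟨t, by simp [pathCompletion_self, (pathCompletion_le t (t + 1)).trans h]⟩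
  · exact ⟨t + 1, by simp [pathCompletion_self, (pathCompletion_le (t + 1) t).trans h]⟩

theorem cycleEdge_eq (hmax : maxEdgeWeight ω ≤ δ) (t : Fin n) :
    cycleEdge ω δ t = orientedEdge (dowkerFiltration ω δ) t (t + 1) :=
  if_pos (maxEdgeWeight_le_iff.1 hmax t)

theorem fundamentalChain_mem_cycles (hmax : maxEdgeWeight ω ≤ δ) :
    fundamentalChain ω δ ∈ cycles (dowkerFiltration ω δ) 1 := by
  change boundary _ 0 (fundamentalChain ω δ) = 0
  have h : ∀ t, boundary _ 0 (cycleEdge ω δ t) = _ := fun t => by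
    rw [cycleEdge_eq hmax, boundary_orientedEdge (pair_mem_of_maxEdgeWeight_le hmax t)
      singleton_mem_dowkerFiltration]
  rw [fundamentalChain, map_sum, Finset.sum_congr rfl fun t _ => h t, Finset.sum_sub_distrib,
    sub_eq_zero]
  exact Fintype.sum_equiv (Equiv.addRight 1) _ _ fun t => rfl

/-- An arc that is filled at scale `δ` makes its edge path homologous to the edge from `k` to
`s`. -/
theorem IsArc.orientedEdge_sub_cutPotential_mem (hn : 3 ≤ n) (hG : IsCycleNetwork ω)
    {A : Finset (Fin n)} {r : Fin n → ℕ} (h : IsArc ω k s A r) (hs : IsSink ω s)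
    (hks : k ≠ s) (hδ : δ < ∞) {m : Fin n}
    (hm : m = k ∨ m = s) (hm' : m + 1 ∉ A)
    (hA : ¬ A.Nonempty → ω k s ≤ δ ∧ ¬ (k = m ∧ s = m + 1) ∧ ¬ (s = m ∧ k = m + 1))
    (hval : arcValue (pathCompletion ω) k s A ≤ δ) :
    orientedEdge (dowkerFiltration ω δ) k s -
      (cutPotential (cycleEdge ω δ) m s - cutPotential (cycleEdge ω δ) m k) ∈
        boundaries (dowkerFiltration ω δ) 1 := by
  by_cases hne : A.Nonempty
  · obtain ⟨i, hi, h1, h2, h3⟩ := exists_of_arcValue_le hne hval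
    refine h.orientedEdge_sub_mem hs hδ _ ?_ hi h1 h2 h3
    intro y z hyz hw hor
    have hk := h.source_notMem
    have hsA := h.sink_notMem
    have h1' := add_one_ne_self (by omega) m
    have := orientedEdge_sub_cutPotential hn hG hδ m hyz hw
    rw [if_neg, if_neg] at this
    · exact sub_eq_zero.mp this
    -- The ends `m`, `m + 1` of the cut edge are distinct and both outside `A`, while `A ∪ {k}` and
    -- `A ∪ {s}` contain only one such vertex each.
    all_goals grind
  · obtain ⟨h1, h2, h3⟩ := hA hne
    rw [orientedEdge_sub_cutPotential hn hG hδ m hks h1, if_neg h2, if_neg h3]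
    exact zero_mem _

/-- The indicator of the pairs `(s, v)` with `v` a vertex of the arc `A` at distance at most `δ`
to `s`. -/
def sinkIndicator (ω : Network (Fin n)) (δ : ℝ≥0∞) (s : Fin n) (A : Finset (Fin n))
    (u v : Fin n) : ℝ :=
  open Classical in if u = s ∧ v ∈ A ∧ pathCompletion ω v s ≤ δ then 1 else 0

theorem sinkIndicator_cocycle {A : Finset (Fin n)} {r : Fin n → ℕ} (h : IsArc ω k s A r)
    (hk : IsSource ω k) (hs : IsSink ω s) (hδ : δ < ∞)
    (hval : δ < arcValue (pathCompletion ω) k s A) {u v w : Fin n}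
    (hX : ({u, v, w} : Finset (Fin n)) ∈ dowkerFiltration ω δ) :
    (sinkIndicator ω δ s A u v - sinkIndicator ω δ s A v u) +
      (sinkIndicator ω δ s A v w - sinkIndicator ω δ s A w v) =
        sinkIndicator ω δ s A u w - sinkIndicator ω δ s A w u := by
  classical
  obtain ⟨-, x, hx⟩ := mem_dowkerFiltration.1 hX
  have hu := hx u (by simp)
  have hv := hx v (by simp)
  have hw := hx w (by simp)
  by_cases hcase : x ∈ A ∧ pathCompletion ω x s ≤ δ
  · have key : ∀ y, pathCompletion ω x y ≤ δ →
        ((y ∈ A ∧ pathCompletion ω y s ≤ δ) ↔ y ≠ s) := by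
      intro y hy
      constructor
      · rintro ⟨hyA, -⟩ rfl
        exact h.sink_notMem hyA
      · intro hys
        obtain ⟨hyA, hr⟩ :=
          (h.mem_or_eq_sink_of_pathCompletion hs hcase.1 (hy.trans_lt hδ)).resolve_right hys
        exact ⟨hyA, (h.pathCompletion_sink_le hcase.1 hyA hr).trans hcase.2⟩
    simp only [sinkIndicator, key u hu, key v hv, key w hw]
    by_cases a : u = s <;> by_cases b : v = s <;> by_cases c : w = s <;> simp [a, b, c]
  -- Otherwise the cochain vanishes here: a pair `(s, v)` of the support in the ball of `x` forces
  -- `x = k`, and then `v` would witness that the arc is filled.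
  · have key : ∀ y z, pathCompletion ω x y ≤ δ → pathCompletion ω x z ≤ δ →
        sinkIndicator ω δ s A y z = 0 := by
      intro y z hy hz
      refine if_neg ?_
      rintro ⟨rfl, hzA, hzs⟩
      rcases h.mem_or_eq_source_of_pathCompletion hk hzA (hz.trans_lt hδ) with hxA | rfl
      · exact hcase ⟨hxA, hy⟩
      · exact (not_le_of_lt_arcValue hval hzA hy hz).not_ge hzs
    simp [key u v hu hv, key v u hv hu, key v w hv hw, key w v hw hv, key u w hu hw, key w u hw hu]

theorem finrank_eq_one_of_lt_arcValue (hn : 3 ≤ n) (hG : IsCycleNetwork ω) {A : Finset (Fin n)}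
    {r : Fin n → ℕ} (h : IsArc ω k s A r) (hk : IsSource ω k) (hs : IsSink ω s) (hδ : δ < ∞)
    (hmax : maxEdgeWeight ω ≤ δ) (hval : δ < arcValue (pathCompletion ω) k s A)
    (hA : ¬ A.Nonempty → ω k s ≤ δ)
    (hadj : A.Nonempty → (s + 1 ∈ A ∧ s - 1 ∉ A) ∨ (s + 1 ∉ A ∧ s - 1 ∈ A)) :
    Module.finrank ℝ (Homology (dowkerFiltration ω δ) 1) = 1 := by
  classical
  -- An empty arc is the edge from `k` to `s`, whose value `d(k,s)` is at most its weight and so at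
  -- most `δ`.
  have hne : A.Nonempty := by
    by_contra hne
    rw [arcValue, dif_neg hne] at hval
    exact hval.not_ge ((pathCompletion_le k s).trans (hA hne))
  let f : Fin n → Fin n → ℝ := fun u v => sinkIndicator ω δ s A u v - sinkIndicator ω δ s A v u
  have hf : ∀ u v, f v u = - f u v := fun u v => (neg_sub _ _).symm
  refine finrank_homology_one_eq_one (fundamentalChain_mem_cycles hmax)
    (cycles_le_sup_span_fundamentalChain hn hG hδ) (edgeFunctional _ f)
    (edgeFunctional_boundary hf fun u v w hX => sinkIndicator_cocycle h hk hs hδ hval hX) ?_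
  -- Only the two cycle edges at `s` can contribute.
  have hsum : edgeFunctional _ f (fundamentalChain ω δ) =
      sinkIndicator ω δ s A s (s + 1) - sinkIndicator ω δ s A s (s - 1) := by
    rw [fundamentalChain, map_sum]
    have : ∀ t, edgeFunctional _ f (cycleEdge ω δ t) = f t (t + 1) := fun t => by
      rw [cycleEdge_eq hmax,
        edgeFunctional_orientedEdge hf (pair_mem_of_maxEdgeWeight_le hmax t)]
    simp only [this, f]
    rw [Finset.sum_sub_distrib, Finset.sum_eq_single s, Finset.sum_eq_single (s - 1)]
    · simp
    · intro t _ ht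
      refine if_neg fun h => ht ?_
      rw [← h.1]; simp
    · simp
    · intro t _ ht
      exact if_neg fun h => ht h.1
    · simp
  have hnear : ∀ y, y ≠ s → ω y s ≤ δ ∨ ω s y ≤ δ → pathCompletion ω y s ≤ δ := by
    intro y hy hor
    rcases hor with h1 | h1
    · exact (pathCompletion_le y s).trans h1
    · rw [hs y hy] at h1
      exact absurd h1 hδ.not_ge
  rw [hsum]
  have hs1 := maxEdgeWeight_le_iff.1 hmax s
  have hs2 := maxEdgeWeight_le_iff.1 hmax (s - 1)
  rw [sub_add_cancel] at hs2
  rcases hadj hne with ⟨h1, h2⟩ | ⟨h1, h2⟩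
  · have := hnear (s + 1) (by rintro he; rw [he] at h1; exact h.sink_notMem h1) hs1.symm
    simp [sinkIndicator, h1, h2, this]
  · have := hnear (s - 1) (by rintro he; rw [he] at h2; exact h.sink_notMem h2) hs2
    simp [sinkIndicator, h1, h2, this]

end Cycle

/-! ### Homology at every scale -/

section Cycle

variable {n : ℕ} [NeZero n] {ω : Network (Fin n)} {δ : ℝ≥0∞} {k s : Fin n}

theorem IsBipath.ne (hb : IsBipath ω k s) : k ≠ s := by
  rintro rfl
  have := hb.pos
  rw [cyclePos_self] at this
  omega

theorem IsBipath.eq_add_one_of_arcPos_empty (hn : 3 ≤ n) (hb : IsBipath ω k s)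
    (h : ¬ (arcPos k s).Nonempty) : s = k + 1 := by
  have hk := cyclePos_self k
  have hp := hb.pos
  have h1 := cyclePos_add_one (by omega) k k
  have h2 : k + 1 ∉ arcPos k s := fun h' => h ⟨_, h'⟩
  rw [mem_arcPos] at h2
  exact cyclePos_injective k (by omega)

theorem IsBipath.add_one_eq_of_arcNeg_empty (hn : 3 ≤ n) (h : ¬ (arcNeg k s).Nonempty) :
    s + 1 = k := by
  have hk := cyclePos_self k
  have h1 := cyclePos_add_one (by omega) k s
  have h2 : s + 1 ∉ arcNeg k s := fun h' => h ⟨_, h'⟩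
  rw [mem_arcNeg] at h2
  exact cyclePos_injective k (by omega)

theorem IsBipath.le_of_arcPos_empty (hn : 3 ≤ n) (hG : IsCycleNetwork ω) (hb : IsBipath ω k s)
    (hδ : δ < ∞) (hmax : maxEdgeWeight ω ≤ δ) (h : ¬ (arcPos k s).Nonempty) : ω k s ≤ δ := by
  have h1 := maxEdgeWeight_le_iff.1 hmax k
  rw [← hb.eq_add_one_of_arcPos_empty hn h, hb.isSource hn hG s hb.ne.symm] at h1
  exact h1.resolve_right hδ.not_ge

theorem IsBipath.le_of_arcNeg_empty (hn : 3 ≤ n) (hG : IsCycleNetwork ω) (hb : IsBipath ω k s)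
    (hδ : δ < ∞) (hmax : maxEdgeWeight ω ≤ δ) (h : ¬ (arcNeg k s).Nonempty) : ω k s ≤ δ := by
  have h1 := maxEdgeWeight_le_iff.1 hmax s
  rw [add_one_eq_of_arcNeg_empty hn h, hb.isSource hn hG s hb.ne.symm] at h1
  exact h1.resolve_left hδ.not_ge

theorem IsBipath.finrank_homology_one (hn : 3 ≤ n) (hG : IsCycleNetwork ω) (hb : IsBipath ω k s)
    (hmax : maxEdgeWeight ω ≤ δ) (hdeath : δ < deathValue ω k s) :
    Module.finrank ℝ (Homology (dowkerFiltration ω δ) 1) = 1 := by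
  have hδ : δ < ∞ := hdeath.trans_le le_top
  have hsrc := hb.isSource hn hG
  have hsink := (hb.isSink hn hG s).2 rfl
  have hk := cyclePos_self k
  have h1 := cyclePos_add_one (by omega) k s
  have h2 := cyclePos_add_one (by omega) k (s - 1)
  rw [sub_add_cancel] at h2
  have hp := hb.pos
  rcases lt_max_iff.1 hdeath with h | h
  · refine finrank_eq_one_of_lt_arcValue hn hG (hb.isArc_arcPos hn hG) hsrc hsink hδ hmax h
      (hb.le_of_arcPos_empty hn hG hδ hmax) ?_
    rintro ⟨i, hi⟩
    rw [mem_arcPos] at hi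
    simp only [mem_arcPos]
    omega
  · refine finrank_eq_one_of_lt_arcValue hn hG (hb.isArc_arcNeg hn hG) hsrc hsink hδ hmax h
      (hb.le_of_arcNeg_empty hn hG hδ hmax) ?_
    rintro ⟨i, hi⟩
    rw [mem_arcNeg] at hi
    have := cyclePos_lt k i
    simp only [mem_arcNeg]
    omega

theorem IsBipath.fundamentalChain_mem_boundaries (hn : 3 ≤ n) (hG : IsCycleNetwork ω)
    (hb : IsBipath ω k s) (hδ : δ < ∞) (hmax : maxEdgeWeight ω ≤ δ)
    (hdeath : deathValue ω k s ≤ δ) :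
    fundamentalChain ω δ ∈ boundaries (dowkerFiltration ω δ) 1 := by
  have hsink := (hb.isSink hn hG s).2 rfl
  have hk := cyclePos_self k
  have h1 := cyclePos_add_one (by omega) k s
  have h2 := cyclePos_add_one (by omega) k k
  have hp := hb.pos
  have hss := add_one_add_one_ne_self hn s
  have hkk := add_one_add_one_ne_self hn k
  obtain ⟨hpos, hneg⟩ := max_le_iff.1 hdeath
  have hP := (hb.isArc_arcPos hn hG).orientedEdge_sub_cutPotential_mem hn hG hsink hb.ne hδ
    (m := s) (Or.inr rfl) (by rw [mem_arcPos]; omega)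
    (fun he => ⟨hb.le_of_arcPos_empty hn hG hδ hmax he, fun h => hb.ne h.1, fun h => by
      rw [hb.eq_add_one_of_arcPos_empty hn he] at h
      exact hkk h.2.symm⟩) hpos
  have hN := (hb.isArc_arcNeg hn hG).orientedEdge_sub_cutPotential_mem hn hG hsink hb.ne hδ
    (m := k) (Or.inl rfl) (by rw [mem_arcNeg]; omega)
    (fun he => ⟨hb.le_of_arcNeg_empty hn hG hδ hmax he, fun h => by
      rw [← add_one_eq_of_arcNeg_empty hn he] at h
      exact hss h.2.symm, fun h => hb.ne h.1.symm⟩) hneg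
  have := sub_mem hN hP
  rw [sub_sub_sub_cancel_left, cutPotential_sub_sub _ hb.ne] at this
  exact this

theorem IsBipath.subsingleton_homology_one (hn : 3 ≤ n) (hG : IsCycleNetwork ω)
    (hb : IsBipath ω k s) (h : ¬ (maxEdgeWeight ω ≤ δ ∧ δ < deathValue ω k s)) :
    Subsingleton (Homology (dowkerFiltration ω δ) 1) := by
  apply homology_one_subsingleton
  -- At `δ = ∞` absent edges also satisfy `ω y z ≤ δ`, so the edge argument breaks down; there the
  -- complex is a full simplex.
  rcases eq_or_ne δ ∞ with rfl | hδ
  · exact cycles_le_boundaries_of_forall_le k fun _ => le_top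
  rw [← lt_top_iff_ne_top] at hδ
  by_cases hmax : maxEdgeWeight ω ≤ δ
  · refine (cycles_le_sup_span_fundamentalChain hn hG hδ).trans (sup_le le_rfl ?_)
    rw [Submodule.span_singleton_le_iff_mem]
    exact hb.fundamentalChain_mem_boundaries hn hG hδ hmax
      (not_lt.1 fun hlt => h ⟨hmax, hlt⟩)
  · exact cycles_le_boundaries_of_lt_maxEdgeWeight hn hG hδ hmax

end Cycle

end
end DowkerCycle

open DowkerCycle in
theorem mainTheorem7 {n : ℕ} [NeZero n] (hn : 3 ≤ n) (ω : Network (Fin n))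
    (hG : IsCycleNetwork ω) (hinc : ¬ IsConsistentlyOriented ω) (K : Finset (Fin n))
    (hK : Minimal (IsSourceDominating (pathCompletion ω)) K) (hcard : K.card = 1) :
    ∃ k s : Fin n, K = {k} ∧ (∀ v, IsSource ω v ↔ v = k) ∧ (∀ v, IsSink ω v ↔ v = s) ∧
      ∀ δ : ℝ≥0∞,
        (maxEdgeWeight ω ≤ δ ∧ δ < deathValue ω k s →
          Module.finrank ℝ (Homology (dowkerFiltration ω δ) 1) = 1) ∧
        (¬ (maxEdgeWeight ω ≤ δ ∧ δ < deathValue ω k s) →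
          Subsingleton (Homology (dowkerFiltration ω δ) 1)) := by
  obtain ⟨k, rfl⟩ := Finset.card_eq_one.mp hcard
  have hk : ∀ v, pathCompletion ω k v < ∞ := fun v => by simpa using hK.prop v
  obtain ⟨hsrc, s, hb⟩ := exists_isBipath hn hG hinc hk
  refine ⟨k, s, rfl, fun v => ⟨hsrc v, ?_⟩, hb.isSink hn hG, fun δ =>
    ⟨fun h => hb.finrank_homology_one hn hG h.1 h.2, hb.subsingleton_homology_one hn hG⟩⟩
  rintro rfl
  exact hb.isSource hn hG
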